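/- For a positive integer $n$, let $\Omega_n$ be the graph whose vertices are the $\pm1$-vectors of length $n$, two vertices being adjacent when they are orthogonal. Then $$\chi(\Omega_n)=n \iff n=2^k \text{ for some integer } k \text{ with } 0\le k\le 3 .$$ Equivalently, for the following game with parameter an integer $k\ge 0$: Alice and Bob each receive a $01$-vector of length $2^k$ (say $x$ and $y$ respectively), and, without communicating, each respond with a $01$-vector of length $k$. If $x=y$, then their responses must be equal; if $x$ and $y$ differ in exactly half of their $2^k$ positions, then their responses must be distinct. A strategy without entanglement consists of shared prior information (a random element $\lambda$ of a probability space, independent of the questions) together with, for each player and each question, a distribution of the player's response that depends measurably on $\lambda$; given $\lambda$, the two players' responses are drawn independently. The strategy is winning if, for every pair $(x,y)$ of questions, the responses meet the requirements with probability $1$. Then a winning strategy without entanglement exists if and only if $k\le 3$. -/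

import Mathlib

open MeasureTheory

universe u

/-- The graph `Ω n`: its vertices are the `±1`-vectors of length `n` (`ℤˣ = {1, -1}`), and two
distinct vertices are adjacent when they are orthogonal. (Distinctness is automatic for `0 < n`.) -/
def orthogonalityGraph (n : ℕ) : SimpleGraph (Fin n → ℤˣ) where
  Adj x y := x ≠ y ∧ ∑ i, (x i : ℤ) * (y i : ℤ) = 0
  symm := ⟨fun _ _ h => ⟨h.1.symm, by simpa only [mul_comm] using h.2⟩⟩
  loopless := ⟨fun _ h => h.1 rfl⟩

namespace OrthogonalityGame

/-- A question to a player: a `01`-vector of length `2 ^ k`. -/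
abbrev Question (k : ℕ) : Type := Fin (2 ^ k) → Bool

/-- An answer of a player: a `01`-vector of length `k`. -/
abbrev Answer (k : ℕ) : Type := Fin k → Bool

/-- The rule of the game: equal questions require equal answers, and questions that differ in
exactly half of the `2 ^ k` positions require distinct answers. -/
def Correct (k : ℕ) (x y : Question k) (s t : Answer k) : Prop :=
  (x = y → s = t) ∧ (2 * hammingDist x y = 2 ^ k → s ≠ t)

/-- A strategy without entanglement. Alice and Bob share prior information, an element `l` of a
probability space `Info`. Each of them answers depending only on `l`, on their own question and
on private randomness, which is independent of the other player's given `l`: `alice l x` is the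
distribution of Alice's answer to `x`, and `bob l y` is that of Bob's answer to `y`. -/
structure ClassicalStrategy (k : ℕ) where
  Info : Type u
  [measurableSpace : MeasurableSpace Info]
  prior : Measure Info
  [isProbabilityMeasure : IsProbabilityMeasure prior]
  alice : Info → Question k → PMF (Answer k)
  bob : Info → Question k → PMF (Answer k)
  measurable_alice : ∀ x s, Measurable fun l => alice l x s
  measurable_bob : ∀ y t, Measurable fun l => bob l y t

open Classical in
/-- The probability that the answers to the questions `x` (to Alice) and `y` (to Bob) are
correct. -/
noncomputable def ClassicalStrategy.successProbability {k : ℕ} (S : ClassicalStrategy.{u} k)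
    (x y : Question k) : ENNReal :=
  letI := S.measurableSpace
  ∫⁻ l, ∑ s, ∑ t, (if Correct k x y s t then S.alice l x s * S.bob l y t else 0) ∂S.prior

/-- A strategy is winning if it succeeds with probability one on every pair of questions. -/
def ClassicalStrategy.IsWinning {k : ℕ} (S : ClassicalStrategy.{u} k) : Prop :=
  ∀ x y : Question k, S.successProbability x y = 1

end OrthogonalityGame

/-! Suppose `4 ∣ n`. The eigenvalues of `Ω n` are the Fourier coefficients of the indicator of
balanced vectors; with degree `d`, the least is `-d / (n - 1)`, occurring only in weights `2` and `n
- 2`. Hoffman's ratio bound (`ratio_bound`) then gives `n * |S| ≤ 2 ^ n` for every independent `S`,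
and an `n`-colouring would force equality for every colour class. For `n > 8` equality is impossible
(`ratio_ne`). The indicator of `S` would have Fourier support in weights `0, 2, n - 2`, so on even
vectors, where complementary characters agree, it would equal a quadratic `g`. As `g ^ 2 - g` has
degree `4 < n / 2` and vanishes on the even half, `g` is Boolean everywhere. Integrality then makes
four times its constant term, `4 / n`, an integer. For `n = 2 ^ k` with `k ≤ 3`, Walsh rows form an
`n`-clique and explicit colourings exist. The other `n` have `χ ≤ 2`. A winning strategy amounts to
a `2 ^ k`-colouring of `Ω (2 ^ k)`. -/

namespace SignCube

/-! ### Characters and Fourier analysis on the cube. -/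

variable {ι : Type*}

/-- The character `x ↦ ∏ i ∈ T, x i` of the group of `±1`-vectors. -/
def signChar (T : Finset ι) (x : ι → ℤˣ) : ℝ := ∏ i ∈ T, ((x i : ℤ) : ℝ)

lemma units_mul_self_cast (u : ℤˣ) : ((u : ℤ) : ℝ) * ((u : ℤ) : ℝ) = 1 := by
  rcases Int.units_eq_one_or u with rfl | rfl <;> simp

lemma signChar_empty (x : ι → ℤˣ) : signChar ∅ x = 1 := by simp [signChar]

lemma signChar_one (T : Finset ι) : signChar T 1 = 1 := by simp [signChar]

lemma signChar_mul (T : Finset ι) (x y : ι → ℤˣ) :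
    signChar T (x * y) = signChar T x * signChar T y := by
  simp [signChar, Finset.prod_mul_distrib]

lemma signChar_mul_self (T : Finset ι) (x : ι → ℤˣ) : signChar T x * signChar T x = 1 := by
  simp [signChar, ← Finset.prod_mul_distrib, units_mul_self_cast]

lemma signChar_eq_one_or (T : Finset ι) (x : ι → ℤˣ) :
    signChar T x = 1 ∨ signChar T x = -1 :=
  mul_self_eq_one_iff.1 (signChar_mul_self T x)

variable [DecidableEq ι]

open scoped symmDiff in
lemma signChar_symmDiff (S T : Finset ι) (x : ι → ℤˣ) :
    signChar (S ∆ T) x = signChar S x * signChar T x := by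
  have h1 : signChar S x = signChar (S \ T) x * signChar (S ∩ T) x := by
    rw [signChar, signChar, signChar, mul_comm, Finset.prod_inter_mul_prod_sdiff]
  have h2 : signChar T x = signChar (T \ S) x * signChar (S ∩ T) x := by
    rw [signChar, signChar, signChar, mul_comm, Finset.inter_comm,
      Finset.prod_inter_mul_prod_sdiff]
  have h3 : signChar (S ∆ T) x = signChar (S \ T) x * signChar (T \ S) x := by
    rw [signChar, signChar, signChar, symmDiff, Finset.sup_eq_union,
      Finset.prod_union disjoint_sdiff_sdiff]
  rw [h1, h2, h3]
  linear_combination (-signChar (S \ T) x * signChar (T \ S) x) * signChar_mul_self (S ∩ T) x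

lemma signChar_mulSingle_neg_one (T : Finset ι) (i : ι) :
    signChar T (Pi.mulSingle i (-1)) = if i ∈ T then -1 else 1 := by
  have : ∀ j, (((Pi.mulSingle i (-1) : ι → ℤˣ) j : ℤ) : ℝ) = if j = i then -1 else 1 := by
    intro j
    by_cases h : j = i
    · subst h; simp
    · simp [h]
  simp [signChar, this, Finset.prod_ite_eq']

variable [Fintype ι]

lemma signChar_compl (T : Finset ι) (x : ι → ℤˣ) :
    signChar Tᶜ x = signChar Finset.univ x * signChar T x := by
  have h : signChar T x * signChar Tᶜ x = signChar Finset.univ x :=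
    Finset.prod_mul_prod_compl T _
  rw [← h]
  linear_combination (-signChar Tᶜ x) * signChar_mul_self T x

/-- Flipping a coordinate in `T` permutes the cube and negates the sum. -/
lemma sum_signChar_eq_zero {T : Finset ι} (hT : T.Nonempty) :
    ∑ x : ι → ℤˣ, signChar T x = 0 := by
  obtain ⟨i, hi⟩ := hT
  have h : ∑ x : ι → ℤˣ, signChar T x
      = ∑ x, signChar T (Pi.mulSingle i (-1)) * signChar T x := by
    rw [← Equiv.sum_comp (Equiv.mulLeft (Pi.mulSingle i (-1) : ι → ℤˣ))]
    exact Finset.sum_congr rfl fun x _ => signChar_mul T _ x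
  rw [← Finset.mul_sum, signChar_mulSingle_neg_one, if_pos hi] at h
  linarith only [h]

omit [DecidableEq ι] in
/-- Orthogonality of the rows of the character table. -/
lemma sum_signChar_mul_signChar (x y : ι → ℤˣ) :
    ∑ T : Finset ι, signChar T x * signChar T y = if x = y then 2 ^ Fintype.card ι else 0 := by
  -- The sum is an expanded product, one of whose factors vanishes as soon as `x` and `y` differ
  -- somewhere.
  have h : ∑ T : Finset ι, signChar T x * signChar T y
      = ∏ i, (1 + ((x i : ℤ) : ℝ) * ((y i : ℤ) : ℝ)) := by
    rw [Finset.prod_one_add, Finset.powerset_univ]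
    simp [signChar, Finset.prod_mul_distrib]
  rw [h]
  split_ifs with hxy
  · subst hxy
    simp only [units_mul_self_cast]
    norm_num
  · obtain ⟨i, hi⟩ := Function.ne_iff.1 hxy
    refine Finset.prod_eq_zero (Finset.mem_univ i) ?_
    rcases Int.units_eq_one_or (x i) with h1 | h1 <;>
      rcases Int.units_eq_one_or (y i) with h2 | h2 <;> simp_all

/-- The (unnormalised) Fourier coefficients of a function on the cube. -/
def fourier (f : (ι → ℤˣ) → ℝ) (T : Finset ι) : ℝ := ∑ x, f x * signChar T x

lemma sum_fourier_mul_signChar (f : (ι → ℤˣ) → ℝ) (x : ι → ℤˣ) :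
    ∑ T, fourier f T * signChar T x = 2 ^ Fintype.card ι * f x := by
  simp only [fourier, Finset.sum_mul]
  rw [Finset.sum_comm]
  simp only [mul_assoc, ← Finset.mul_sum, sum_signChar_mul_signChar]
  simp [mul_comm]

lemma sum_fourier_sq (f : (ι → ℤˣ) → ℝ) :
    ∑ T, fourier f T ^ 2 = 2 ^ Fintype.card ι * ∑ x, f x ^ 2 := by
  calc ∑ T, fourier f T ^ 2 = ∑ T, ∑ x, f x * (fourier f T * signChar T x) := by
        refine Finset.sum_congr rfl fun T _ => ?_
        rw [sq]
        nth_rewrite 2 [fourier]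
        rw [Finset.mul_sum]
        exact Finset.sum_congr rfl fun x _ => by ring
    _ = _ := by
        rw [Finset.sum_comm, Finset.mul_sum]
        refine Finset.sum_congr rfl fun x _ => ?_
        rw [← Finset.mul_sum, sum_fourier_mul_signChar]
        ring

/-- The quadratic form of a Cayley graph of the cube is diagonalised by the characters. -/
lemma sum_fourier_mul_fourier_sq (a f : (ι → ℤˣ) → ℝ) :
    ∑ T, fourier a T * fourier f T ^ 2
      = 2 ^ Fintype.card ι * ∑ x, ∑ y, a (x * y) * f x * f y := by
  calc ∑ T, fourier a T * fourier f T ^ 2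
      = ∑ T, ∑ x, ∑ y, f x * f y * (fourier a T * signChar T (x * y)) := by
        refine Finset.sum_congr rfl fun T _ => ?_
        rw [sq]
        nth_rewrite 2 [fourier]
        nth_rewrite 2 [fourier]
        rw [Finset.sum_mul_sum, Finset.mul_sum]
        refine Finset.sum_congr rfl fun x _ => ?_
        rw [Finset.mul_sum]
        refine Finset.sum_congr rfl fun y _ => ?_
        rw [signChar_mul]
        ring
    _ = _ := by
        rw [Finset.sum_comm, Finset.mul_sum]
        refine Finset.sum_congr rfl fun x _ => ?_
        rw [Finset.sum_comm, Finset.mul_sum]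
        refine Finset.sum_congr rfl fun y _ => ?_
        rw [← Finset.mul_sum, sum_fourier_mul_signChar]
        ring

/-! ### Polynomials of bounded degree on the cube. -/

/-- The functions on the cube given by polynomials of degree at most `d`. -/
def polyDegreeLE (ι : Type*) [Fintype ι] [DecidableEq ι] (d : ℕ) :
    Submodule ℝ ((ι → ℤˣ) → ℝ) :=
  Submodule.span ℝ (signChar '' {T | T.card ≤ d})

lemma signChar_mem_polyDegreeLE {T : Finset ι} {d : ℕ} (h : T.card ≤ d) :
    signChar T ∈ polyDegreeLE ι d :=
  Submodule.subset_span ⟨T, h, rfl⟩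

lemma polyDegreeLE_mono {d e : ℕ} (h : d ≤ e) : polyDegreeLE ι d ≤ polyDegreeLE ι e :=
  Submodule.span_mono (Set.image_mono fun _ hT => le_trans hT h)

lemma mul_mem_polyDegreeLE {d e : ℕ} {p q : (ι → ℤˣ) → ℝ} (hp : p ∈ polyDegreeLE ι d)
    (hq : q ∈ polyDegreeLE ι e) : p * q ∈ polyDegreeLE ι (d + e) := by
  have h := Submodule.mul_mem_mul hp hq
  rw [polyDegreeLE, polyDegreeLE, Submodule.span_mul_span] at h
  refine Submodule.span_mono ?_ h
  rintro _ ⟨_, ⟨S, hS, rfl⟩, _, ⟨T, hT, rfl⟩, rfl⟩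
  refine ⟨symmDiff S T, ?_, funext fun x => signChar_symmDiff S T x⟩
  have h1 : (symmDiff S T).card ≤ S.card + T.card :=
    (Finset.card_le_card symmDiff_le_sup).trans (Finset.card_union_le S T)
  exact h1.trans (add_le_add hS hT)

lemma sum_mul_signChar_univ_eq_zero {d : ℕ} (hd : d < Fintype.card ι) {p : (ι → ℤˣ) → ℝ}
    (hp : p ∈ polyDegreeLE ι d) : ∑ x, p x * signChar Finset.univ x = 0 := by
  induction hp using Submodule.span_induction with
  | mem p hp =>
    obtain ⟨T, hT, rfl⟩ := hp
    have hT' : T.card ≤ d := hT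
    have h : ∀ x, signChar T x * signChar Finset.univ x = signChar Tᶜ x := fun x => by
      rw [signChar_compl, mul_comm]
    simp only [h]
    refine sum_signChar_eq_zero ?_
    rw [← Finset.card_pos, Finset.card_compl]
    omega
  | zero => simp
  | add p q _ _ hp hq => simp [add_mul, Finset.sum_add_distrib, hp, hq]
  | smul c p _ hp => simp [mul_assoc, ← Finset.mul_sum, hp]

/-- A polynomial of degree less than half the dimension is determined by its values on the even
half of the cube. -/
lemma eq_zero_of_eq_zero_on_even {d : ℕ} (hd : d + d < Fintype.card ι) {p : (ι → ℤˣ) → ℝ}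
    (hp : p ∈ polyDegreeLE ι d) (h : ∀ x, signChar Finset.univ x = 1 → p x = 0) : p = 0 := by
  have h1 := sum_mul_signChar_univ_eq_zero hd (mul_mem_polyDegreeLE hp hp)
  -- By `h1`, `p ^ 2` has equal totals over the even and the odd half, and the even total is zero.
  have h2 : ∑ x, p x * p x = 0 := by
    rw [← neg_eq_zero, ← h1, ← Finset.sum_neg_distrib]
    refine Finset.sum_congr rfl fun x _ => ?_
    rcases signChar_eq_one_or Finset.univ x with hx | hx
    · simp [h x hx]
    · simp [hx]
  rw [Finset.sum_eq_zero_iff_of_nonneg fun x _ => mul_self_nonneg _] at h2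
  exact funext fun x => mul_self_eq_zero.1 (h2 x (Finset.mem_univ x))

/-- If a polynomial with constant and quadratic terms only is integer valued on the cube, then
four times its constant term is an integer. -/
lemma exists_int_eq_four_mul_const {a : ℝ} {c : Finset ι → ℝ}
    (h : ∀ x : ι → ℤˣ, ∃ m : ℤ,
      a + ∑ T ∈ Finset.univ.powersetCard 2, c T * signChar T x = m) :
    ∃ m : ℤ, 4 * a = m := by
  choose g hg using h
  have hc : ∀ T ∈ (Finset.univ : Finset ι).powersetCard 2, ∃ m : ℤ, 4 * c T = m := by
    intro T hT
    obtain ⟨i, j, hij, rfl⟩ := Finset.card_eq_two.1 (Finset.mem_powersetCard.1 hT).2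
    -- The mixed second difference at `1` in directions `i` and `j` kills every quadratic term but
    -- `{i, j}`, which it multiplies by `4`.
    let e : ι → ι → ℤˣ := fun i => Pi.mulSingle i (-1)
    refine ⟨g 1 - g (e i) - g (e j) + g (e i * e j), ?_⟩
    have key : ∑ T ∈ (Finset.univ : Finset ι).powersetCard 2, c T *
        ((1 - signChar T (e i)) * (1 - signChar T (e j))) = 4 * c {i, j} := by
      rw [Finset.sum_eq_single_of_mem _ hT]
      · simp only [e, signChar_mulSingle_neg_one]
        simp
        ring
      · intro S hS hne
        simp only [e, signChar_mulSingle_neg_one]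
        by_cases hi : i ∈ S
        · by_cases hj : j ∈ S
          · exact absurd (Finset.eq_of_subset_of_card_le
              (Finset.insert_subset hi (Finset.singleton_subset_iff.2 hj))
              (by rw [(Finset.mem_powersetCard.1 hS).2, Finset.card_pair hij])).symm hne
          · simp [hj]
        · simp [hi]
    push_cast
    rw [← hg, ← hg, ← hg, ← hg, ← key]
    simp only [signChar_one, signChar_mul]
    have : ∀ A B C D : ℝ, a + A - (a + B) - (a + C) + (a + D) = A - B - C + D := by
      intros; ring
    rw [this, ← Finset.sum_sub_distrib, ← Finset.sum_sub_distrib, ← Finset.sum_add_distrib]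
    exact Finset.sum_congr rfl fun S _ => by ring
  choose! k hk using hc
  refine ⟨4 * g 1 - ∑ T ∈ (Finset.univ : Finset ι).powersetCard 2, k T, ?_⟩
  have h1 := hg 1
  simp only [signChar_one, mul_one] at h1
  push_cast
  rw [← h1, ← Finset.sum_congr rfl hk, ← Finset.mul_sum]
  ring

end SignCube

/-! ### Eigenvalues of the orthogonality graph. -/

namespace SignCube

section Balanced

variable {ι : Type*} [Fintype ι]

lemma sum_eq_card_sub (z : ι → ℤˣ) :
    ∑ i, (z i : ℤ) = Fintype.card ι - 2 * (Finset.univ.filter fun i => z i = -1).card := by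
  have h : ∀ i, (z i : ℤ) = 1 - 2 * if z i = -1 then 1 else 0 := by
    intro i
    rcases Int.units_eq_one_or (z i) with h | h <;> simp [h]
  rw [Finset.sum_congr rfl fun i _ => h i, Finset.sum_sub_distrib, ← Finset.mul_sum]
  simp

lemma signChar_univ_eq (z : ι → ℤˣ) :
    signChar Finset.univ z = (-1) ^ (Finset.univ.filter fun i => z i = -1).card := by
  have h : ∀ i, ((z i : ℤ) : ℝ) = if z i = -1 then -1 else 1 := by
    intro i
    rcases Int.units_eq_one_or (z i) with h | h <;> simp [h]
  rw [signChar, Finset.prod_congr rfl fun i _ => h i, Finset.prod_ite]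
  simp

/-- Half of the entries are `-1`, and half of a multiple of `4` is even. -/
lemma signChar_univ_of_sum_eq_zero (h4 : 4 ∣ Fintype.card ι) {z : ι → ℤˣ}
    (hz : ∑ i, (z i : ℤ) = 0) : signChar Finset.univ z = 1 := by
  rw [sum_eq_card_sub] at hz
  rw [signChar_univ_eq]
  exact Even.neg_one_pow (Nat.even_iff.2 (by omega))

/-- The indicator function of the balanced vectors. -/
def balanced (z : ι → ℤˣ) : ℝ := if ∑ i, (z i : ℤ) = 0 then 1 else 0

lemma balanced_comp_perm (σ : Equiv.Perm ι) (z : ι → ℤˣ) : balanced (z ∘ σ) = balanced z := by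
  simp only [balanced, Function.comp_apply]
  rw [Equiv.sum_comp σ fun i => (z i : ℤ)]

variable [DecidableEq ι]

lemma fourier_balanced_empty_pos (h : Even (Fintype.card ι)) :
    0 < fourier (balanced (ι := ι)) ∅ := by
  obtain ⟨m, hm⟩ := h
  obtain ⟨T, -, hT⟩ := Finset.exists_subset_card_eq (s := (Finset.univ : Finset ι)) (n := m)
    (by rw [Finset.card_univ]; omega)
  simp only [fourier, signChar_empty, mul_one]
  refine Finset.sum_pos' (fun z _ => ?_) ⟨fun i => if i ∈ T then -1 else 1, Finset.mem_univ _, ?_⟩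
  · unfold balanced; split_ifs <;> norm_num
  · rw [balanced, if_pos]
    · norm_num
    · rw [sum_eq_card_sub]
      have : (Finset.univ.filter fun i => (if i ∈ T then (-1 : ℤˣ) else 1) = -1) = T := by
        ext i
        by_cases hi : i ∈ T <;> simp [hi]
      rw [this, hT, hm]
      push_cast
      ring

lemma fourier_balanced_compl (h4 : 4 ∣ Fintype.card ι) (T : Finset ι) :
    fourier balanced Tᶜ = fourier balanced T := by
  refine Finset.sum_congr rfl fun z _ => ?_
  by_cases hz : ∑ i, (z i : ℤ) = 0
  · rw [signChar_compl, signChar_univ_of_sum_eq_zero h4 hz, one_mul]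
  · simp [balanced, hz]

lemma fourier_balanced_map (σ : Equiv.Perm ι) (T : Finset ι) :
    fourier balanced (T.map σ.toEmbedding) = fourier balanced T := by
  unfold fourier
  rw [← Equiv.sum_comp (Equiv.arrowCongr σ (Equiv.refl ℤˣ))]
  refine Finset.sum_congr rfl fun z _ => ?_
  congr 1
  · exact balanced_comp_perm σ.symm z
  · simp [signChar, Equiv.arrowCongr]

/-- The eigenvalues depend only on the weight of the character. -/
lemma exists_fourier_balanced_eq_card :
    ∃ K : ℕ → ℝ, ∀ T : Finset ι, fourier balanced T = K T.card := by
  have h : Function.FactorsThrough (fourier (balanced (ι := ι))) Finset.card := by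
    intro S T hST
    let e : {x // x ∈ S} ≃ {x // x ∈ T} := Finset.equivOfCardEq hST
    have : S.map e.extendSubtype.toEmbedding = T := by
      refine Finset.eq_of_subset_of_card_le (fun j hj => ?_) (by simp [hST])
      obtain ⟨i, hi, rfl⟩ := Finset.mem_map.1 hj
      exact e.extendSubtype_mem i hi
    rw [← this, fourier_balanced_map]
  obtain ⟨K, hK⟩ := (Function.factorsThrough_iff _).1 h
  exact ⟨K, fun T => congrFun hK T⟩

/-- Summing the characters of `symmDiff T {i}` over `i` gives `signChar T z * ∑ i, z i`, which
vanishes on balanced `z`. This is the source of the recurrence. -/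
lemma sum_fourier_balanced_symmDiff (T : Finset ι) :
    ∑ i, fourier balanced (symmDiff T {i}) = 0 := by
  simp only [fourier, signChar_symmDiff]
  rw [Finset.sum_comm]
  refine Finset.sum_eq_zero fun z _ => ?_
  rw [← Finset.mul_sum, ← Finset.mul_sum]
  by_cases hz : ∑ i, (z i : ℤ) = 0
  · have : ∑ i, signChar {i} z = 0 := by
      simp only [signChar, Finset.prod_singleton]
      exact_mod_cast hz
    rw [this, mul_zero, mul_zero]
  · simp [balanced, hz]

/-- The three-term recurrence for the eigenvalues. -/
lemma weight_recurrence {K : ℕ → ℝ} (hK : ∀ T : Finset ι, fourier balanced T = K T.card) {t : ℕ}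
    (ht : t ≤ Fintype.card ι) :
    (t : ℝ) * K (t - 1) + (Fintype.card ι - t) * K (t + 1) = 0 := by
  -- The truncated `t - 1` at `t = 0` and the out-of-range weight at `t = n` both carry coefficient
  -- zero.
  obtain ⟨T, -, hT⟩ := Finset.exists_subset_card_eq (s := (Finset.univ : Finset ι)) (n := t)
    (by rwa [Finset.card_univ])
  have h := sum_fourier_balanced_symmDiff T
  rw [← Finset.sum_add_sum_compl T] at h
  have h1 : ∀ i ∈ T, fourier balanced (symmDiff T {i}) = K (t - 1) := by
    intro i hi
    have : symmDiff T {i} = T.erase i := by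
      ext j; by_cases hj : j = i <;> simp [Finset.mem_symmDiff, hj, hi]
    rw [this, hK, Finset.card_erase_of_mem hi, hT]
  have h2 : ∀ i ∈ Tᶜ, fourier balanced (symmDiff T {i}) = K (t + 1) := by
    intro i hi
    have hi' : i ∉ T := Finset.mem_compl.1 hi
    have : symmDiff T {i} = insert i T := by
      ext j; by_cases hj : j = i <;> simp [Finset.mem_symmDiff, hj, hi']
    rw [this, hK, Finset.card_insert_of_notMem hi', hT]
  rw [Finset.sum_congr rfl h1, Finset.sum_congr rfl h2] at h
  simpa [Finset.card_compl, hT, Nat.cast_sub ht] using h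

/-- In weights `1, …, n / 2` the largest absolute value of an eigenvalue occurs in weight `2`
only. -/
lemma abs_le_of_weight_recurrence {K : ℕ → ℝ} {n : ℕ} (h0 : 0 < K 0)
    (hrec : ∀ t ≤ n, (t : ℝ) * K (t - 1) + (n - t) * K (t + 1) = 0) {s : ℕ} (hs : 1 ≤ s)
    (hsn : 2 * s ≤ n) :
    |K s| ≤ K 0 / (n - 1) ∧ (s ≠ 2 → |K s| < K 0 / (n - 1)) := by
  have hn : (2 : ℝ) ≤ n := by exact_mod_cast (by omega : 2 ≤ n)
  have hpos : 0 < K 0 / (n - 1 : ℝ) := div_pos h0 (by linarith)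
  induction s using Nat.strong_induction_on with
  | _ s ih =>
    rcases (by omega : s = 1 ∨ s = 2 ∨ 3 ≤ s) with rfl | rfl | h3
    · have h := hrec 0 (by omega)
      have : K 1 = 0 := by
        simp only [Nat.cast_zero, zero_mul, zero_add, sub_zero, mul_eq_zero] at h
        exact h.resolve_left (by linarith)
      rw [this, abs_zero]
      exact ⟨hpos.le, fun _ => hpos⟩
    · have h := hrec 1 (by omega)
      have h1 : K 2 = -(K 0 / (n - 1)) := by
        have : (n - 1 : ℝ) ≠ 0 := by linarith
        norm_num at h
        field_simp
        linarith
      rw [h1, abs_neg, abs_of_pos hpos]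
      exact ⟨le_rfl, fun h => absurd rfl h⟩
    · obtain ⟨r, rfl⟩ : ∃ r, s = r + 2 := ⟨s - 2, by omega⟩
      have h := hrec (r + 1) (by omega)
      have hr := (ih r (by omega) (by omega) (by omega)).1
      have hrn : 2 * ((r : ℝ) + 2) ≤ n := by exact_mod_cast hsn
      have hr0 : (0 : ℝ) ≤ r := Nat.cast_nonneg r
      push_cast at h
      simp only [add_assoc] at h
      norm_num at h
      have habs : (n - (r + 1) : ℝ) * |K (r + 2)| = (r + 1) * |K r| := by
        rw [← abs_of_pos (by linarith : (0 : ℝ) < n - (r + 1)), ← abs_mul,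
          ← abs_of_pos (by linarith : (0 : ℝ) < r + 1), ← abs_mul,
          abs_of_pos (by linarith : (0 : ℝ) < r + 1), ← abs_neg]
        congr 1
        linarith
      -- Since `2 * (r + 2) ≤ n`, the factor `r + 1` is less than `n - (r + 1)`, so absolute values
      -- shrink strictly.
      have hlt : |K (r + 2)| < K 0 / (n - 1) := by
        by_contra! hcon
        nlinarith
      exact ⟨hlt.le, fun _ => hlt⟩

lemma fourier_balanced_bound (h4 : 4 ∣ Fintype.card ι) {T : Finset ι} (hT : T.Nonempty) :
    0 ≤ fourier balanced T + fourier (balanced (ι := ι)) ∅ / (Fintype.card ι - 1) ∧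
    (T.card ≠ 2 → T.card ≠ Fintype.card ι - 2 →
      0 < fourier balanced T + fourier (balanced (ι := ι)) ∅ / (Fintype.card ι - 1)) := by
  obtain ⟨K, hK⟩ := exists_fourier_balanced_eq_card (ι := ι)
  have h0 : 0 < K 0 := by
    rw [← Finset.card_empty (α := ι), ← hK]
    exact fourier_balanced_empty_pos ((by decide : Even 4).trans_dvd h4)
  have hTc : 0 < T.card := hT.card_pos
  have hTn : T.card ≤ Fintype.card ι := Finset.card_le_univ T
  have hcompl : K (Fintype.card ι - T.card) = K T.card := by
    rw [← Finset.card_compl, ← hK, ← hK, fourier_balanced_compl h4]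
  have hrec := fun t (ht : t ≤ Fintype.card ι) => weight_recurrence hK ht
  rw [hK, hK, Finset.card_empty]
  set n := Fintype.card ι
  have main : ∀ s, 1 ≤ s → 2 * s ≤ n →
      0 ≤ K s + K 0 / (n - 1) ∧ (s ≠ 2 → 0 < K s + K 0 / (n - 1)) := by
    intro s hs hsn
    obtain ⟨h1, h2⟩ := abs_le_of_weight_recurrence h0 hrec hs hsn
    exact ⟨by linarith [(abs_le.1 h1).1], fun h => by linarith [(abs_lt.1 (h2 h)).1]⟩
  by_cases hle : 2 * T.card ≤ n
  · obtain ⟨h1, h2⟩ := main _ hTc hle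
    exact ⟨h1, fun h _ => h2 h⟩
  · rw [← hcompl]
    by_cases heq : T.card = n
    · have hn : (2 : ℝ) ≤ n := by exact_mod_cast (by omega : 2 ≤ n)
      -- Weight `n` has the same eigenvalue as weight `0`, which `main` does not cover.
      have : 0 < K 0 / (n - 1 : ℝ) := div_pos h0 (by linarith)
      rw [heq, Nat.sub_self]
      exact ⟨by linarith, fun _ _ => by linarith⟩
    · obtain ⟨h1, h2⟩ := main (n - T.card) (by omega) (by omega)
      exact ⟨h1, fun _ h => h2 (by omega)⟩

/-! ### The ratio bound and its equality case. -/

/-- The indicator function of a set of vertices. -/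
def vertexIndicator (S : Finset (ι → ℤˣ)) (x : ι → ℤˣ) : ℝ := if x ∈ S then 1 else 0

lemma fourier_vertexIndicator_empty (S : Finset (ι → ℤˣ)) :
    fourier (vertexIndicator S) ∅ = S.card := by
  simp [fourier, vertexIndicator, signChar_empty]

/-- The identity behind the ratio bound for sets without orthogonal pairs. -/
lemma ratio_identity {S : Finset (ι → ℤˣ)} (h2 : 2 ≤ Fintype.card ι)
    (hS : ∀ x ∈ S, ∀ y ∈ S, ∑ i, (x i : ℤ) * (y i : ℤ) ≠ 0) :
    ∑ T ∈ Finset.univ.erase ∅,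
      (fourier balanced T + fourier (balanced (ι := ι)) ∅ / (Fintype.card ι - 1)) *
        fourier (vertexIndicator S) T ^ 2
      = fourier (balanced (ι := ι)) ∅ / (Fintype.card ι - 1) * S.card *
        (2 ^ Fintype.card ι - Fintype.card ι * S.card) := by
  have hn : (2 : ℝ) ≤ Fintype.card ι := by exact_mod_cast h2
  have hn' : (Fintype.card ι - 1 : ℝ) ≠ 0 := by linarith
  have hquad := sum_fourier_mul_fourier_sq balanced (vertexIndicator S)
  have hzero : ∑ x, ∑ y, balanced (x * y) * vertexIndicator S x * vertexIndicator S y = 0 := by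
    refine Finset.sum_eq_zero fun x _ => Finset.sum_eq_zero fun y _ => ?_
    by_cases hx : x ∈ S
    · by_cases hy : y ∈ S
      · simp [balanced, hS x hx y hy]
      · simp [vertexIndicator, hy]
    · simp [vertexIndicator, hx]
  rw [hzero, mul_zero] at hquad
  have hpars := sum_fourier_sq (vertexIndicator S)
  have hcard : ∑ x, vertexIndicator S x ^ 2 = S.card := by
    simp [vertexIndicator]
  rw [hcard] at hpars
  have hsplit := Finset.add_sum_erase Finset.univ (fun T : Finset ι =>
    (fourier balanced T + fourier (balanced (ι := ι)) ∅ / (Fintype.card ι - 1)) *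
        fourier (vertexIndicator S) T ^ 2) (Finset.mem_univ ∅)
  simp only [add_mul, Finset.sum_add_distrib, ← Finset.mul_sum, hquad, hpars] at hsplit
  simp only [add_mul, Finset.sum_add_distrib, ← Finset.mul_sum]
  rw [fourier_vertexIndicator_empty] at hsplit
  -- The term at `∅` has coefficient `K 0 * (1 + 1 / (n - 1)) = K 0 * n / (n - 1)`, writing `K 0`
  -- for the degree.
  have hid : fourier (balanced (ι := ι)) ∅ * (S.card : ℝ) ^ 2
      + fourier (balanced (ι := ι)) ∅ / (Fintype.card ι - 1) * (S.card : ℝ) ^ 2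
      = fourier (balanced (ι := ι)) ∅ / (Fintype.card ι - 1) * S.card *
        (Fintype.card ι * S.card) := by
    field_simp
    ring
  linarith

lemma ratio_bound (h4 : 4 ∣ Fintype.card ι) (hpos : 0 < Fintype.card ι) {S : Finset (ι → ℤˣ)}
    (hS : ∀ x ∈ S, ∀ y ∈ S, ∑ i, (x i : ℤ) * (y i : ℤ) ≠ 0) :
    Fintype.card ι * S.card ≤ 2 ^ Fintype.card ι := by
  have h2 : 2 ≤ Fintype.card ι := by omega
  have hn : (2 : ℝ) ≤ Fintype.card ι := by exact_mod_cast h2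
  have hmu : 0 < fourier (balanced (ι := ι)) ∅ / (Fintype.card ι - 1 : ℝ) :=
    div_pos (fourier_balanced_empty_pos ((by decide : Even 4).trans_dvd h4)) (by linarith)
  have h := ratio_identity h2 hS
  have hnonneg : 0 ≤ ∑ T ∈ Finset.univ.erase ∅,
      (fourier balanced T + fourier (balanced (ι := ι)) ∅ / (Fintype.card ι - 1)) *
        fourier (vertexIndicator S) T ^ 2 :=
    Finset.sum_nonneg fun T hT => mul_nonneg (fourier_balanced_bound h4
      (Finset.nonempty_iff_ne_empty.2 (Finset.ne_of_mem_erase hT))).1 (sq_nonneg _)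
  rcases S.card.eq_zero_or_pos with h0 | h0
  · simp [h0]
  · rw [h] at hnonneg
    have hs : (0 : ℝ) < S.card := by exact_mod_cast h0
    have := nonneg_of_mul_nonneg_right hnonneg (mul_pos hmu hs)
    have h3 : (Fintype.card ι : ℝ) * S.card ≤ 2 ^ Fintype.card ι := by linarith
    exact_mod_cast h3

/-- Equality in the ratio bound forces the Fourier support into the weights `0`, `2`, `n - 2`. -/
lemma fourier_eq_zero_of_ratio_eq (h4 : 4 ∣ Fintype.card ι) (hpos : 0 < Fintype.card ι)
    {S : Finset (ι → ℤˣ)}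
    (hS : ∀ x ∈ S, ∀ y ∈ S, ∑ i, (x i : ℤ) * (y i : ℤ) ≠ 0)
    (heq : Fintype.card ι * S.card = 2 ^ Fintype.card ι) {T : Finset ι} (hT : T.card ≠ 0)
    (hT2 : T.card ≠ 2) (hTn : T.card ≠ Fintype.card ι - 2) :
    fourier (vertexIndicator S) T = 0 := by
  have h := ratio_identity (by omega) hS
  have heq' : (Fintype.card ι : ℝ) * S.card = 2 ^ Fintype.card ι := by exact_mod_cast heq
  rw [heq', sub_self, mul_zero, Finset.sum_eq_zero_iff_of_nonneg] at h
  · have hne : T.Nonempty := Finset.card_ne_zero.1 hT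
    have h1 := h T (Finset.mem_erase.2 ⟨hne.ne_empty, Finset.mem_univ T⟩)
    rw [mul_eq_zero] at h1
    exact pow_eq_zero_iff two_ne_zero |>.1
      (h1.resolve_left ((fourier_balanced_bound h4 hne).2 hT2 hTn).ne')
  · exact fun T hT => mul_nonneg (fourier_balanced_bound h4
      (Finset.nonempty_iff_ne_empty.2 (Finset.ne_of_mem_erase hT))).1 (sq_nonneg _)

/-- Complementation pairs weight `2` with weight `n - 2`; `n > 4` keeps these weights distinct. -/
lemma sum_eq_of_support {F : Finset ι → ℝ} (h4 : 4 < Fintype.card ι)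
    (hF : ∀ T : Finset ι, T.card ≠ 0 → T.card ≠ 2 → T.card ≠ Fintype.card ι - 2 → F T = 0) :
    ∑ T, F T = F ∅ + ∑ T ∈ Finset.univ.powersetCard 2, (F T + F Tᶜ) := by
  have h1 : ∑ T ∈ Finset.univ.powersetCard 2, F Tᶜ
      = ∑ T ∈ (Finset.univ : Finset ι).powersetCard (Fintype.card ι - 2), F T := by
    refine Finset.sum_nbij' compl compl ?_ ?_ ?_ ?_ ?_
    · intro T hT
      simp only [Finset.mem_powersetCard_univ, Finset.card_compl] at hT ⊢
      omega
    · intro T hT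
      simp only [Finset.mem_powersetCard_univ, Finset.card_compl] at hT ⊢
      omega
    all_goals simp
  rw [Finset.sum_add_distrib, h1, ← Finset.sum_union, ← Finset.sum_insert]
  · refine (Finset.sum_subset (Finset.subset_univ _) fun T _ hT => ?_).symm
    simp only [Finset.mem_insert, Finset.mem_union, Finset.mem_powersetCard_univ, not_or] at hT
    exact hF T (by simpa using hT.1) hT.2.1 hT.2.2
  · simp only [Finset.mem_union, Finset.mem_powersetCard_univ, Finset.card_empty]
    omega
  · rw [Finset.disjoint_left]
    intro T h h'
    simp only [Finset.mem_powersetCard_univ] at h h'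
    omega

/-- A polynomial with constant and quadratic terms only which is `0` or `1` valued on the even half
of the cube is so on the whole cube if `n > 8`. -/
lemma eq_zero_or_one_of_even (h8 : 8 < Fintype.card ι) {a : ℝ} {c : Finset ι → ℝ}
    {g : (ι → ℤˣ) → ℝ}
    (hg : ∀ x, g x = a + ∑ T ∈ Finset.univ.powersetCard 2, c T * signChar T x)
    (h : ∀ x, signChar Finset.univ x = 1 → g x = 0 ∨ g x = 1) (x : ι → ℤˣ) :
    g x = 0 ∨ g x = 1 := by
  have hdeg : g ∈ polyDegreeLE ι 2 := by
    have : g = a • signChar ∅ + ∑ T ∈ Finset.univ.powersetCard 2, c T • signChar T := by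
      funext x
      rw [hg, Pi.add_apply, Finset.sum_apply, Pi.smul_apply, signChar_empty, smul_eq_mul, mul_one]
      rfl
    rw [this]
    refine add_mem (Submodule.smul_mem _ _ (signChar_mem_polyDegreeLE (by simp)))
      (sum_mem fun T hT => Submodule.smul_mem _ _ (signChar_mem_polyDegreeLE ?_))
    exact (Finset.mem_powersetCard_univ.1 hT).le
  have hsq : g * g ∈ polyDegreeLE ι (2 + 2) := mul_mem_polyDegreeLE hdeg hdeg
  have hmem : g * g - g ∈ polyDegreeLE ι (2 + 2) :=
    Submodule.sub_mem _ hsq (polyDegreeLE_mono (Nat.le_add_right 2 2) hdeg)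
  -- The degree condition `4 + 4 < n` is where `n > 8` enters.
  have hidem := eq_zero_of_eq_zero_on_even (by omega) hmem fun x hx => by
    rw [Pi.sub_apply, Pi.mul_apply]
    rcases h x hx with h0 | h0 <;> rw [h0] <;> norm_num
  have hx : g x * g x - g x = 0 := congrFun hidem x
  have h1 : g x * (g x - 1) = 0 := by linarith only [hx]
  exact (mul_eq_zero.1 h1).imp_right sub_eq_zero.1

/-- The ratio bound is not attained for `n > 8`. -/
lemma ratio_ne (h4 : 4 ∣ Fintype.card ι) (h8 : 8 < Fintype.card ι) {S : Finset (ι → ℤˣ)}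
    (hS : ∀ x ∈ S, ∀ y ∈ S, ∑ i, (x i : ℤ) * (y i : ℤ) ≠ 0) :
    Fintype.card ι * S.card ≠ 2 ^ Fintype.card ι := by
  intro heq
  obtain ⟨F, hF⟩ : ∃ F, F = fourier (vertexIndicator S) := ⟨_, rfl⟩
  obtain ⟨N, hN⟩ : ∃ N : ℝ, N = 2 ^ Fintype.card ι := ⟨_, rfl⟩
  have hN0 : N ≠ 0 := by rw [hN]; positivity
  have hsupp : ∀ T : Finset ι, T.card ≠ 0 → T.card ≠ 2 → T.card ≠ Fintype.card ι - 2 →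
      F T = 0 := fun T h0 h2 hn => by
    rw [hF]
    exact fourier_eq_zero_of_ratio_eq h4 (by omega) hS heq h0 h2 hn
  -- The coefficient at `Tᶜ` is folded into that at `T`, as the two characters agree on even
  -- vectors.
  obtain ⟨c, hc⟩ : ∃ c : Finset ι → ℝ, ∀ T, c T = (F T + F Tᶜ) / N := ⟨_, fun _ => rfl⟩
  obtain ⟨g, hg⟩ : ∃ g : (ι → ℤˣ) → ℝ, ∀ x,
      g x = S.card / N + ∑ T ∈ Finset.univ.powersetCard 2, c T * signChar T x :=
    ⟨_, fun _ => rfl⟩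
  have hg_even : ∀ x, signChar Finset.univ x = 1 → g x = vertexIndicator S x := by
    intro x hx
    have h1 := sum_fourier_mul_signChar (vertexIndicator S) x
    rw [← hF, ← hN, sum_eq_of_support (by omega) fun T h0 h2 hn => by
      rw [hsupp T h0 h2 hn, zero_mul]] at h1
    simp only [signChar_compl, hx, one_mul, signChar_empty, mul_one, ← add_mul] at h1
    rw [hF, fourier_vertexIndicator_empty, ← hF] at h1
    have h2 : g x = (S.card + ∑ T ∈ Finset.univ.powersetCard 2,
        (F T + F Tᶜ) * signChar T x) / N := by
      rw [hg, add_div, Finset.sum_div]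
      congr 1
      exact Finset.sum_congr rfl fun T _ => by rw [hc]; ring
    rw [h2, h1, mul_div_cancel_left₀ _ hN0]
  have hbool := eq_zero_or_one_of_even h8 hg fun x hx => by
    rw [hg_even x hx, vertexIndicator]
    split_ifs
    · exact Or.inr rfl
    · exact Or.inl rfl
  obtain ⟨m, hm⟩ := exists_int_eq_four_mul_const (a := S.card / N) (c := c) fun x => by
    rw [← hg]
    rcases hbool x with h | h
    · exact ⟨0, by rw [h, Int.cast_zero]⟩
    · exact ⟨1, by rw [h, Int.cast_one]⟩
  have heq' : (Fintype.card ι : ℝ) * S.card = N := by rw [hN]; exact_mod_cast heq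
  -- The constant term is `1 / n`, so `4 / n` would be the integer `m`.
  have hna : (Fintype.card ι : ℝ) * (S.card / N) = 1 := by
    rw [← mul_div_assoc, heq', div_self hN0]
  have h5 : (Fintype.card ι : ℤ) * m = 4 := by
    have : (Fintype.card ι : ℝ) * m = 4 := by rw [← hm]; linarith
    exact_mod_cast this
  have h6 := Int.le_of_dvd (by norm_num) (Dvd.intro m h5)
  omega

end Balanced

end SignCube

open SignCube in
/-- For `n` divisible by `4` and greater than `8`, the graph `Ω n` is not `n`-colourable. -/
theorem orthogonalityGraph_not_colorable {n : ℕ} (h4 : 4 ∣ n) (h8 : 8 < n) :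
    ¬ (orthogonalityGraph n).Colorable n := by
  rintro ⟨C⟩
  let S : Fin n → Finset (Fin n → ℤˣ) := fun j => Finset.univ.filter fun x => C x = j
  have hS : ∀ j, ∀ x ∈ S j, ∀ y ∈ S j, ∑ i, (x i : ℤ) * (y i : ℤ) ≠ 0 := by
    intro j x hx y hy h0
    have hx' : C x = j := (Finset.mem_filter.1 hx).2
    have hy' : C y = j := (Finset.mem_filter.1 hy).2
    refine C.valid (v := x) (w := y) ⟨?_, h0⟩ (hx'.trans hy'.symm)
    rintro rfl
    have : ∀ i, (x i : ℤ) * (x i : ℤ) = 1 := fun i => by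
      rcases Int.units_eq_one_or (x i) with h | h <;> simp [h]
    simp [this] at h0
    omega
  have hsum : ∑ j, (S j).card = 2 ^ n := by
    rw [← Finset.card_eq_sum_card_fiberwise fun x _ => Finset.mem_univ (C x)]
    simp
  have hlt : ∀ j, n * (S j).card < 2 ^ n := fun j => by
    refine lt_of_le_of_ne ?_ ?_
    · simpa using ratio_bound (ι := Fin n) (by simpa using h4) (by simp; omega) (hS j)
    · simpa using ratio_ne (ι := Fin n) (by simpa using h4) (by simpa using h8) (hS j)
  have : ∑ j, n * (S j).card < ∑ _j : Fin n, 2 ^ n :=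
    Finset.sum_lt_sum_of_nonempty ⟨⟨0, by omega⟩, Finset.mem_univ _⟩ fun j _ => hlt j
  rw [← Finset.mul_sum, hsum] at this
  simp at this

/-! ### Winning strategies and colourings. -/

namespace OrthogonalityGame

open Classical in
/-- From a winning classical strategy one extracts a single value of the shared information for
which all incorrect pairs of answers are impossible, and reads off a colouring. -/
lemma exists_answer_of_isWinning {k : ℕ} {S : ClassicalStrategy.{u} k} (h : S.IsWinning) :
    ∃ c : Question k → Answer k, ∀ x y, 2 * hammingDist x y = 2 ^ k → c x ≠ c y := by
  let _ := S.measurableSpace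
  have := S.isProbabilityMeasure
  let p : Question k → Question k → S.Info → ENNReal := fun x y l =>
    ∑ s, ∑ t, (if Correct k x y s t then S.alice l x s * S.bob l y t else 0)
  have htot : ∀ x y l, ∑ s, ∑ t, S.alice l x s * S.bob l y t = 1 := by
    intro x y l
    have hsum : ∀ P : PMF (Answer k), ∑ s, P s = 1 := fun P => by
      rw [← P.tsum_coe, tsum_fintype]
    rw [← Finset.sum_mul_sum, hsum, hsum, one_mul]
  have hle : ∀ x y l, p x y l ≤ 1 := fun x y l => by
    rw [← htot x y l]
    refine Finset.sum_le_sum fun s _ => Finset.sum_le_sum fun t _ => ?_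
    split_ifs
    · exact le_rfl
    · exact zero_le
  have hmeas : ∀ x y, Measurable (p x y) := fun x y => by
    refine Finset.measurable_sum _ fun s _ => Finset.measurable_sum _ fun t _ => ?_
    split_ifs
    · exact (S.measurable_alice x s).mul (S.measurable_bob y t)
    · exact measurable_const
  -- A function bounded by `1` with integral `1` is `1` almost everywhere; finitely many question
  -- pairs share one null set.
  have hae : ∀ᵐ l ∂S.prior, ∀ x y, p x y l = 1 := by
    rw [ae_all_iff]
    intro x
    rw [ae_all_iff]
    intro y
    have hint : ∫⁻ l, p x y l ∂S.prior = 1 := h x y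
    refine ae_eq_of_ae_le_of_lintegral_le (g := fun _ => 1) (.of_forall (hle x y)) ?_
      aemeasurable_const ?_
    · rw [hint]; exact ENNReal.one_ne_top
    · rw [hint]; simp
  obtain ⟨l, hl⟩ := hae.exists
  have hcorrect : ∀ x y s t, s ∈ (S.alice l x).support → t ∈ (S.bob l y).support →
      Correct k x y s t := by
    intro x y s t hs ht
    by_contra hcon
    have hsplit : p x y l
        + ∑ s, ∑ t, (if Correct k x y s t then 0 else S.alice l x s * S.bob l y t) = 1 := by
      rw [← htot x y l, ← Finset.sum_add_distrib]
      refine Finset.sum_congr rfl fun s _ => ?_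
      rw [← Finset.sum_add_distrib]
      refine Finset.sum_congr rfl fun t _ => ?_
      split_ifs <;> simp
    have hzero := (ENNReal.add_right_inj ENNReal.one_ne_top).1
      ((hl x y ▸ hsplit).trans (add_zero 1).symm)
    have h1 := Finset.sum_eq_zero_iff.1
      (Finset.sum_eq_zero_iff.1 hzero s (Finset.mem_univ s)) t (Finset.mem_univ t)
    rw [if_neg hcon, mul_eq_zero] at h1
    exact h1.elim ((PMF.mem_support_iff _ _).1 hs) ((PMF.mem_support_iff _ _).1 ht)
  -- Any possible answer of Alice will do: on equal questions it must agree with every possible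
  -- answer of Bob.
  choose c hc using fun x => (S.alice l x).support_nonempty
  refine ⟨c, fun x y hxy => ?_⟩
  obtain ⟨t, ht⟩ := (S.bob l y).support_nonempty
  rw [(hcorrect y y _ t (hc y) ht).1 rfl]
  exact (hcorrect x y _ t (hc x) ht).2 hxy

open Classical in
lemma exists_isWinning_of_answer {k : ℕ} {c : Question k → Answer k}
    (hc : ∀ x y, 2 * hammingDist x y = 2 ^ k → c x ≠ c y) :
    ∃ S : ClassicalStrategy.{u} k, S.IsWinning := by
  let S : ClassicalStrategy.{u} k :=
    { Info := PUnit.{u + 1}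
      measurableSpace := ⊤
      prior := @Measure.dirac _ ⊤ PUnit.unit
      isProbabilityMeasure := @Measure.dirac.isProbabilityMeasure _ ⊤ _
      alice := fun _ x => PMF.pure (c x)
      bob := fun _ y => PMF.pure (c y)
      measurable_alice := fun _ _ => @measurable_const _ _ _ ⊤ _
      measurable_bob := fun _ _ => @measurable_const _ _ _ ⊤ _ }
  refine ⟨S, fun x y => ?_⟩
  have hcor : Correct k x y (c x) (c y) := ⟨fun h => congrArg c h, hc x y⟩
  have : ∀ s t, (if Correct k x y s t then PMF.pure (c x) s * PMF.pure (c y) t else 0)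
      = if s = c x then (if t = c y then (1 : ENNReal) else 0) else 0 := by
    intro s t
    by_cases hs : s = c x <;> by_cases ht : t = c y <;> simp [hs, ht, hcor]
  simp only [ClassicalStrategy.successProbability, S, this]
  simp

end OrthogonalityGame

/-! ### Cliques and colourings in small cases. -/

lemma sum_mul_eq_sub_hammingDist {n : ℕ} (x y : Fin n → ℤˣ) :
    ∑ i, (x i : ℤ) * (y i : ℤ) = n - 2 * hammingDist x y := by
  have h : ∀ i, (x i : ℤ) * (y i : ℤ) = 1 - 2 * if x i ≠ y i then 1 else 0 := by
    intro i
    rcases Int.units_eq_one_or (x i) with h1 | h1 <;>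
      rcases Int.units_eq_one_or (y i) with h2 | h2 <;> simp [h1, h2]
  rw [Finset.sum_congr rfl fun i _ => h i, Finset.sum_sub_distrib, ← Finset.mul_sum, hammingDist,
    Finset.card_filter]
  simp

lemma orthogonalityGraph_adj_iff {n : ℕ} (hn : 0 < n) {x y : Fin n → ℤˣ} :
    (orthogonalityGraph n).Adj x y ↔ 2 * hammingDist x y = n := by
  have h := sum_mul_eq_sub_hammingDist x y
  refine ⟨fun hxy => ?_, fun hxy => ⟨?_, ?_⟩⟩
  · have := hxy.2
    omega
  · rintro rfl
    simp at hxy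
    omega
  · omega

/-- The bijection between `01`-entries and `±1`-entries. -/
def boolEquivUnits : Bool ≃ ℤˣ where
  toFun b := if b then -1 else 1
  invFun u := decide (u = -1)
  left_inv := by decide
  right_inv := by decide

open OrthogonalityGame in
lemma colorable_iff_exists_answer {k : ℕ} :
    (orthogonalityGraph (2 ^ k)).Colorable (2 ^ k) ↔
      ∃ c : Question k → Answer k, ∀ x y, 2 * hammingDist x y = 2 ^ k → c x ≠ c y := by
  have hpos : 0 < 2 ^ k := by positivity
  have hcard : Fintype.card (Answer k) = 2 ^ k := by simp
  constructor
  · intro h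
    let C := h.toColoring (α := Answer k) hcard.ge
    refine ⟨fun x => C fun i => boolEquivUnits (x i), fun x y hxy => C.valid ?_⟩
    rwa [orthogonalityGraph_adj_iff hpos,
      hammingDist_comp (fun _ => boolEquivUnits) fun _ => boolEquivUnits.injective]
  · rintro ⟨c, hc⟩
    let C : (orthogonalityGraph (2 ^ k)).Coloring (Answer k) :=
      SimpleGraph.Coloring.mk (fun x => c fun i => boolEquivUnits.symm (x i)) fun {x y} hxy => by
        rw [orthogonalityGraph_adj_iff hpos] at hxy
        refine hc _ _ ?_
        rwa [hammingDist_comp (fun _ => boolEquivUnits.symm)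
          fun _ => boolEquivUnits.symm.injective]
    exact hcard ▸ C.colorable

/-- The leading entries of the `±1`-valued Walsh matrix, those with row indices below `8`. -/
def walsh (i j : ℕ) : ℤˣ :=
  (-1) ^ (((i &&& j).testBit 0).toNat + ((i &&& j).testBit 1).toNat + ((i &&& j).testBit 2).toNat)

lemma walsh_orthogonal {k : ℕ} (hk : k ≤ 3) :
    ∀ i j : Fin (2 ^ k), i ≠ j →
      2 * hammingDist (fun l : Fin (2 ^ k) => walsh i l) (fun l => walsh j l) = 2 ^ k := by
  interval_cases k <;> decide +kernel

lemma le_chromaticNumber {k : ℕ} (hk : k ≤ 3) :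
    ((2 ^ k : ℕ) : ℕ∞) ≤ (orthogonalityGraph (2 ^ k)).chromaticNumber := by
  refine SimpleGraph.le_chromaticNumber_iff_colorable.2 fun m hm => ?_
  obtain ⟨C⟩ := hm
  have hinj : Function.Injective fun i : Fin (2 ^ k) => C fun l : Fin (2 ^ k) => walsh i l := by
    intro i j hij
    by_contra hne
    exact C.valid ((orthogonalityGraph_adj_iff (by positivity)).2 (walsh_orthogonal hk i j hne)) hij
  simpa using Fintype.card_le_of_injective _ hinj

lemma orthogonalityGraph_colorable_one {n : ℕ} (hn : n % 2 = 1) :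
    (orthogonalityGraph n).Colorable 1 :=
  ⟨SimpleGraph.Coloring.mk (fun _ => 0) fun {x y} h => by
    have := (orthogonalityGraph_adj_iff (by omega)).1 h
    omega⟩

-- Here `n / 2` is odd, so orthogonal vectors have opposite parity and the graph is bipartite.
open SignCube in
lemma orthogonalityGraph_colorable_two {n : ℕ} (hn : n % 4 = 2) :
    (orthogonalityGraph n).Colorable 2 := by
  classical
  refine ⟨SimpleGraph.Coloring.mk
    (fun x => if signChar Finset.univ x = 1 then 0 else 1) fun {x y} h => ?_⟩
  have hz : ∑ i, ((x * y) i : ℤ) = 0 := by simpa using h.2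
  rw [sum_eq_card_sub, Fintype.card_fin] at hz
  have hodd : signChar Finset.univ (x * y) = -1 := by
    rw [signChar_univ_eq]
    exact Odd.neg_one_pow (Nat.odd_iff.2 (by omega))
  rw [signChar_mul] at hodd
  rcases signChar_eq_one_or Finset.univ x with h1 | h1 <;>
    rcases signChar_eq_one_or Finset.univ y with h2 | h2 <;> rw [h1, h2] at hodd <;>
    first | (exfalso; norm_num at hodd; done) | norm_num [h1, h2]

lemma hammingDist_eq_tail {n : ℕ} (x y : Fin (n + 1) → ℤˣ) :
    hammingDist x y = (if x 0 ≠ y 0 then 1 else 0) + hammingDist (Fin.tail x) (Fin.tail y) := by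
  rw [hammingDist, hammingDist, Finset.card_filter, Finset.card_filter, Fin.sum_univ_succ]
  rfl

lemma hammingDist_neg_self {n : ℕ} (x : Fin n → ℤˣ) : hammingDist x (-x) = n := by
  have h : ∀ u : ℤˣ, u ≠ -u := by decide
  simp [hammingDist, h]

/-- A covering of the cube of dimension `n` by `n + 1` pairs of antipodal balls of small radius
yields a colouring of `Ω (n + 1)`. -/
lemma colorable_of_covering {n r : ℕ} (hr : 4 * r + 2 < n + 1) (D : Fin (n + 1) → Fin n → ℤˣ)
    (hD : ∀ w, ∃ j, hammingDist w (D j) ≤ r ∨ hammingDist w (-D j) ≤ r) :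
    (orthogonalityGraph (n + 1)).Colorable (n + 1) := by
  choose c hc using hD
  refine ⟨SimpleGraph.Coloring.mk (fun x => c (Fin.tail x)) fun {x y} h heq => ?_⟩
  -- Tails of the same colour are at distance at most `2 * r` or at least `n - 2 * r`, whereas
  -- adjacency puts them at `(n + 1) / 2` or one less; `hr` separates these ranges.
  rw [orthogonalityGraph_adj_iff n.succ_pos, hammingDist_eq_tail] at h
  have hx := hc (Fin.tail x)
  have hy := hc (Fin.tail y)
  rw [← heq] at hy
  generalize D (c (Fin.tail x)) = d at hx hy
  generalize Fin.tail x = x' at *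
  generalize Fin.tail y = y' at *
  have hd := hammingDist_neg_self d
  have h1 := hammingDist_triangle_right x' y' d
  have h2 := hammingDist_triangle_right x' y' (-d)
  have h3 := hammingDist_triangle_left d (-d) x'
  have h4 := hammingDist_triangle_left d (-d) y'
  have h5 := hammingDist_triangle x' y' d
  have h6 := hammingDist_triangle x' y' (-d)
  split_ifs at h <;> omega

lemma colorable_two_pow {k : ℕ} (hk : k ≤ 3) : (orthogonalityGraph (2 ^ k)).Colorable (2 ^ k) := by
  interval_cases k
  · exact orthogonalityGraph_colorable_one rfl
  · exact orthogonalityGraph_colorable_two rfl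
  · refine colorable_of_covering (n := 3) (r := 0) (by norm_num) (fun j i => walsh j (i + 1)) ?_
    decide +kernel
  -- Deleting the constant column from the Walsh rows and their negatives leaves the 16 words of the
  -- perfect Hamming code of length `7`.
  · refine colorable_of_covering (n := 7) (r := 1) (by norm_num) (fun j i => walsh j (i + 1)) ?_
    decide +kernel

lemma colorable_two_pow_iff {k : ℕ} :
    (orthogonalityGraph (2 ^ k)).Colorable (2 ^ k) ↔ k ≤ 3 := by
  refine ⟨fun h => ?_, colorable_two_pow⟩
  by_contra! hk
  have h16 : 2 ^ 4 ≤ 2 ^ k := Nat.pow_le_pow_right two_pos hk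
  exact orthogonalityGraph_not_colorable ((by norm_num : 4 ∣ 2 ^ 4).trans (pow_dvd_pow 2 hk))
    (by omega) h

lemma chromaticNumber_eq_iff {n : ℕ} (hn : 0 < n) :
    (orthogonalityGraph n).chromaticNumber = (n : ℕ∞) ↔ ∃ k : ℕ, k ≤ 3 ∧ n = 2 ^ k := by
  constructor
  · intro h
    have hle : ∀ {m : ℕ}, (orthogonalityGraph n).Colorable m → n ≤ m := fun hm => by
      have := hm.chromaticNumber_le
      rw [h] at this
      exact_mod_cast this
    rcases (by omega : n % 2 = 1 ∨ n % 4 = 2 ∨ n % 4 = 0) with h1 | h2 | h4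
    · have := hle (orthogonalityGraph_colorable_one h1)
      exact ⟨0, by norm_num, by omega⟩
    · have := hle (orthogonalityGraph_colorable_two h2)
      exact ⟨1, by norm_num, by omega⟩
    · have h8 : ¬ 8 < n := fun h8 => orthogonalityGraph_not_colorable
        (Nat.dvd_of_mod_eq_zero h4) h8 (SimpleGraph.chromaticNumber_le_iff_colorable.1 h.le)
      rcases (by omega : n = 4 ∨ n = 8) with rfl | rfl
      · exact ⟨2, by norm_num, by norm_num⟩
      · exact ⟨3, by norm_num, by norm_num⟩
  · rintro ⟨k, hk, rfl⟩
    exact le_antisymm (colorable_two_pow hk).chromaticNumber_le (le_chromaticNumber hk)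

theorem mainTheorem1 :
    (∀ n : ℕ, 0 < n →
      ((orthogonalityGraph n).chromaticNumber = (n : ℕ∞) ↔ ∃ k : ℕ, k ≤ 3 ∧ n = 2 ^ k)) ∧
    (∀ k : ℕ, (∃ S : OrthogonalityGame.ClassicalStrategy.{u} k, S.IsWinning) ↔ k ≤ 3) := by
  refine ⟨fun n hn => chromaticNumber_eq_iff hn, fun k => ?_⟩
  rw [← colorable_two_pow_iff, colorable_iff_exists_answer]
  exact ⟨fun ⟨_, hS⟩ => OrthogonalityGame.exists_answer_of_isWinning hS,
    fun ⟨_, hc⟩ => OrthogonalityGame.exists_isWinning_of_answer hc⟩
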